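/- All digraphs are finite, without loops and without multiple arcs (two opposite arcs between a pair of vertices are allowed), and connected, meaning that the underlying undirected graph is connected. The dichromatic number of a digraph $G$ is the least $r$ such that the vertex set of $G$ can be partitioned into $r$ sets each of which induces a subdigraph without directed cycles. Let $\mathcal G_{n,r}$ be the set of connected digraphs of order $n$ with dichromatic number $r$. The Laplacian matrix of $G$ is $L(G)=D^+(G)-A(G)$, where $A(G)$ is the adjacency matrix and $D^+(G)$ the diagonal matrix of outdegrees, and the Laplacian energy of $G$ is $LE(G)=\sum_{i=1}^n\lambda_i^2$, where $\lambda_1,\dots,\lambda_n$ are the complex eigenvalues of $L(G)$ with algebraic multiplicity (this sum is real). An in-tree is an orientation of an undirected tree in which every vertex has outdegree at most one; its root is its unique vertex of outdegree $0$. For a vertex set $S$ of $G$ we say that $G$ is its core $G[S]$ with hanging in-trees if every component $T$ (if any) of $G-S$ is an in-tree and there is exactly one arc between $T$ and $S$, going from the root of $T$ to a vertex of $S$. Theorem. Let $G\in\mathcal G_{n,r}$. (i) Let $r=2$. If $n=2$, then $LE(G)\ge 4$, with equality if and only if $G$ is the directed cycle $C_2$. If $n\ge 3$, then $LE(G)\ge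 n$, with equality if and only if for some $n'\ge 3$ there is a vertex set $S$ of $G$ such that the induced subdigraph $G[S]$ is a directed cycle $C_{n'}$ and $G$ is this core with hanging in-trees. (ii) Let $r\ge 3$. Then $LE(G)\ge n+r^3-r^2-r$, with equality if and only if there is a vertex set $S$ of $G$ such that $G[S]$ is the bidirected complete graph $\overset{\leftrightarrow}{K}_r$ (all ordered pairs of distinct vertices are arcs) and $G$ is this core with hanging in-trees. All these bounds are attained for all $n\ge r\ge 2$, so they are the minimum of $LE$ over $\mathcal G_{n,r}$. -/

import Mathlib

open scoped ComplexOrder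

namespace Digraph

noncomputable section

variable {V : Type*}

/-- The subdigraph of `G` induced by the vertex set `s`. -/
def induce (G : Digraph V) (s : Set V) : Digraph s where
  Adj u v := G.Adj u v

/-- The digraphs `G` and `H` are isomorphic. -/
def IsIsomorphic {W : Type*} (G : Digraph V) (H : Digraph W) : Prop :=
  Nonempty (G.Adj ≃r H.Adj)

/-- The directed cycle `C_l` on the vertices `0, …, l - 1`, with the arcs `i → i + 1` modulo `l`. -/
def directedCycle (l : ℕ) : Digraph (Fin l) where
  Adj i j := finRotate l i = j

/-- The bidirected graph of `H`: every edge is replaced by two opposite arcs. -/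
def bidirected (H : SimpleGraph V) : Digraph V where
  Adj := H.Adj

/-- `G` has no directed cycle: no sequence of `l ≥ 1` distinct vertices `c 0, …, c (l - 1)` such
that `c i → c (i + 1)` is an arc for every `i` modulo `l`. -/
def IsAcyclic (G : Digraph V) : Prop :=
  ∀ (l : ℕ) (c : Fin l → V), 0 < l → Function.Injective c →
    ¬ ∀ i, G.Adj (c i) (c (finRotate l i))

/-- `f` is a colouring all of whose colour classes induce acyclic subdigraphs. -/
def IsAcyclicColoring (G : Digraph V) {r : ℕ} (f : V → Fin r) : Prop :=
  ∀ i, (G.induce (f ⁻¹' {i})).IsAcyclic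

/-- The dichromatic number: the least `r` such that the vertices can be partitioned into `r`
acyclic sets. (Empty colour classes are allowed here; this does not change the minimum.) -/
def dichromaticNumber (G : Digraph V) : ℕ :=
  sInf {r | ∃ f : V → Fin r, G.IsAcyclicColoring f}

/-- The number of arcs with tail `v`. -/
def outdegree (G : Digraph V) (v : V) : ℕ :=
  {w | G.Adj v w}.ncard

open Classical in
/-- The 0-1 adjacency matrix. -/
def adjMatrix (G : Digraph V) : Matrix V V ℂ :=
  Matrix.of fun u v => if G.Adj u v then 1 else 0

/-- The Laplacian matrix: the diagonal matrix of the outdegrees minus the adjacency matrix. -/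
def lapMatrix [DecidableEq V] (G : Digraph V) : Matrix V V ℂ :=
  Matrix.diagonal (fun v => (G.outdegree v : ℂ)) - G.adjMatrix

/-- The `k`-th Laplacian spectral moment: the sum of the `k`-th powers of the complex eigenvalues of
the Laplacian matrix, taken with their algebraic multiplicities. -/
def laplacianMoment [Fintype V] [DecidableEq V] (k : ℕ) (G : Digraph V) : ℂ :=
  (G.lapMatrix.charpoly.roots.map fun z => z ^ k).sum

/-- The Laplacian energy. It is a sum of squares of complex numbers; inequalities
`(a : ℂ) ≤ G.laplacianEnergy` with `a` real refer to the partial order of `ℂ` and include the claim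
that the energy is a real number. -/
def laplacianEnergy [Fintype V] [DecidableEq V] (G : Digraph V) : ℂ :=
  G.laplacianMoment 2

/-- The connected digraphs without loops on the vertex type `V` that have dichromatic number `r`.
Connectedness refers to the underlying undirected graph. -/
def withDichromaticNumber (V : Type*) (r : ℕ) : Set (Digraph V) :=
  {G | (∀ v, ¬ G.Adj v v) ∧ G.toSimpleGraphInclusive.Connected ∧ G.dichromaticNumber = r}

/-- A directed tree: an undirected tree each of whose edges is given one direction. -/
def IsDirectedTree (T : Digraph V) : Prop :=
  T.toSimpleGraphInclusive.IsTree ∧ ∀ u v, T.Adj u v → ¬ T.Adj v u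

/-- An in-tree: a directed tree in which every outdegree is at most one. -/
def IsInTree (T : Digraph V) : Prop :=
  T.IsDirectedTree ∧ ∀ v, T.outdegree v ≤ 1

/-- The root of an in-tree: the vertex of outdegree zero. -/
def IsRoot (T : Digraph V) (v : V) : Prop :=
  T.outdegree v = 0

/-- The connected components of the digraph `G`, that is, of its underlying undirected graph. -/
abbrev Component (G : Digraph V) : Type _ :=
  G.toSimpleGraphInclusive.ConnectedComponent

/-- `G` consists of its subdigraph induced by the core `S` and of in-trees that hang off it:
every component `T` of `G - S` is an in-tree, and the only arc between `T` and `S` is one arc from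
the root of `T` to a vertex of `S`. -/
def HasHangingInTrees (G : Digraph V) (S : Set V) : Prop :=
  ∀ C : (G.induce Sᶜ).Component,
    ((G.induce Sᶜ).induce C.supp).IsInTree ∧
    ∀ v : C.supp,
      (((G.induce Sᶜ).induce C.supp).IsRoot v → ∃! w, w ∈ S ∧ G.Adj v w) ∧
      (¬ ((G.induce Sᶜ).induce C.supp).IsRoot v → ∀ w ∈ S, ¬ G.Adj v w) ∧
      ∀ w ∈ S, ¬ G.Adj w v

end

end Digraph

/-!
The trace of the squared Laplacian is the sum of the squared outdegrees plus the number of ordered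
pairs of vertices joined by two opposite arcs. Take a minimal vertex set `S` that cannot be split
into `r - 1` acyclic sets. By greedy colouring, all outdegrees within `S` are at least `r - 1`.
Connectedness provides, for each vertex outside of `S`, an arc of its own that starts outside of `S`
or leaves `S`. Hence `LE(G) ≥ LE(G[S]) + |V \ S|`, and equality forces every vertex outside of `S`
to have exactly one out-arc, which leads towards `S`: these are the hanging in-trees.

It remains to bound `LE(G[S]) - |S|`. For `r = 2` it is nonnegative, and it vanishes if all
outdegrees are one and no arc is reversed, so that `S` is a directed cycle. For `r ≥ 3`, a set of
`r` vertices is complete, a set of `r + 1` vertices contains many pairs of opposite arcs, and on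
larger sets the squared outdegrees already exceed the bound. The one borderline case is `r = 3`,
`|S| = 5` with all outdegrees two and no opposite arcs; there `S` splits into a vertex with its two
out-neighbours and the two remaining vertices, both acyclic.
-/

namespace LaplacianEnergy

open Digraph Finset

section Spectral

open Polynomial

variable {n K : Type*} [Fintype n] [DecidableEq n] [Field K] [IsAlgClosed K]

theorem det_aeval (A : Matrix n n K) (q : K[X]) :
    (aeval A q).det = (A.charpoly.roots.map fun z => q.eval z).prod := by
  have hcard : Fintype.card n = A.charpoly.roots.card := by
    rw [← (IsAlgClosed.splits A.charpoly).natDegree_eq_card_roots, A.charpoly_natDegree_eq_dim]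
  have hconst (c : K) : (aeval A (C c)).det = (A.charpoly.roots.map fun _ => c).prod := by
    rw [aeval_C, Algebra.algebraMap_eq_smul_one, Matrix.det_smul, Matrix.det_one, mul_one,
      Multiset.map_const', Multiset.prod_replicate, hcard]
  have hlinear (μ : K) :
      (aeval A (X - C μ)).det = (A.charpoly.roots.map fun z => z - μ).prod := by
    have heval := (IsAlgClosed.splits A.charpoly).eval_eq_prod_roots_of_monic A.charpoly_monic μ
    have hneg : aeval A (X - C μ) = -(Matrix.scalar n μ - A) := by
      rw [map_sub, aeval_X, aeval_C, neg_sub]; rfl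
    rw [hneg, Matrix.det_neg, ← Matrix.eval_charpoly, heval, hcard,
      ← Multiset.card_map (fun z => μ - z), ← Multiset.prod_map_neg, Multiset.map_map]
    simp only [Function.comp_def, neg_sub]
  have hsplit := (IsAlgClosed.splits q).eq_prod_roots
  generalize q.roots = s at hsplit
  rw [hsplit]
  clear hsplit
  induction s using Multiset.induction_on with
  | empty => simpa using hconst q.leadingCoeff
  | cons μ s ih =>
    rw [Multiset.map_cons, Multiset.prod_cons, mul_left_comm, map_mul, Matrix.det_mul, hlinear, ih,
      ← Multiset.prod_map_mul]
    simp only [eval_mul, eval_sub, eval_X, eval_C]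

theorem roots_charpoly_aeval (A : Matrix n n K) (p : K[X]) :
    (aeval A p).charpoly.roots = A.charpoly.roots.map fun z => p.eval z := by
  have hprod : (aeval A p).charpoly =
      ((A.charpoly.roots.map fun z => p.eval z).map fun z => X - C z).prod := by
    refine Polynomial.funext fun w => ?_
    have hshift : Matrix.scalar n w - aeval A p = aeval A (C w - p) := by
      rw [map_sub, aeval_C]; rfl
    rw [Matrix.eval_charpoly, hshift, det_aeval, eval_multiset_prod, Multiset.map_map,
      Multiset.map_map]
    simp only [Function.comp_def, eval_sub, eval_X, eval_C]
  rw [hprod, roots_multiset_prod_X_sub_C]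

theorem sum_roots_charpoly_pow (A : Matrix n n K) (k : ℕ) :
    (A.charpoly.roots.map fun z => z ^ k).sum = (A ^ k).trace := by
  have h := roots_charpoly_aeval A (X ^ k)
  simp only [map_pow, aeval_X, eval_pow, eval_X] at h
  rw [Matrix.trace_eq_sum_roots_charpoly, h]

end Spectral

variable {V : Type*} {G : Digraph V}

/-- The digraph formed by the digons of `G`: the arcs whose reversal is also an arc. -/
def symmetricPart (G : Digraph V) : Digraph V where
  Adj u v := G.Adj u v ∧ G.Adj v u

open Classical in
/-- The number of arcs from `v` to the vertex set `S`. -/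
noncomputable def outdegreeIn (G : Digraph V) (S : Finset V) (v : V) : ℕ :=
  #{w ∈ S | G.Adj v w}

/-- The Laplacian energy of the subdigraph induced by `S`, as the trace of its squared Laplacian:
squared outdegrees come from the diagonal of the Laplacian, digons from outside of it. -/
noncomputable def energyOn (G : Digraph V) (S : Finset V) : ℕ :=
  ∑ v ∈ S, (outdegreeIn G S v ^ 2 + outdegreeIn (symmetricPart G) S v)

theorem outdegree_eq_outdegreeIn_univ [Fintype V] (v : V) :
    G.outdegree v = outdegreeIn G univ v := by
  classical
  rw [outdegree, outdegreeIn, ← Set.ncard_coe_finset, coe_filter_univ]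

theorem laplacianEnergy_eq_energyOn [Fintype V] [DecidableEq V] (hG : ∀ v, ¬ G.Adj v v) :
    G.laplacianEnergy = (energyOn G univ : ℂ) := by
  classical
  have hdiag (u : V) : G.lapMatrix u u = outdegreeIn G univ u := by
    simp [lapMatrix, adjMatrix, hG, outdegree_eq_outdegreeIn_univ]
  have hoff (u v : V) (huv : v ≠ u) :
      G.lapMatrix u v * G.lapMatrix v u = if (symmetricPart G).Adj u v then 1 else 0 := by
    by_cases h : G.Adj u v <;> by_cases h' : G.Adj v u <;>
      simp [lapMatrix, adjMatrix, symmetricPart, huv, huv.symm, h, h']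
  have hrow (u : V) : ∑ v, G.lapMatrix u v * G.lapMatrix v u =
      (outdegreeIn G univ u ^ 2 + outdegreeIn (symmetricPart G) univ u : ℂ) := by
    have hdigons : outdegreeIn (symmetricPart G) univ u =
        ∑ v ∈ univ.erase u, if (symmetricPart G).Adj u v then 1 else 0 := by
      have hloop : ¬ (symmetricPart G).Adj u u := fun h => hG u h.1
      rw [outdegreeIn, card_filter, ← add_sum_erase _ _ (mem_univ u), if_neg hloop, zero_add]
    rw [← add_sum_erase _ _ (mem_univ u), hdiag, ← pow_two, hdigons,
      sum_congr rfl fun v hv => hoff u v (ne_of_mem_erase hv)]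
    push_cast
    rfl
  rw [laplacianEnergy, laplacianMoment, sum_roots_charpoly_pow, pow_two, Matrix.trace, energyOn]
  push_cast
  exact sum_congr rfl fun u _ => hrow u

section Outdegree

variable {S T : Finset V} {u v : V}

theorem outdegreeIn_mono (hST : S ⊆ T) : outdegreeIn G S v ≤ outdegreeIn G T v := by
  classical
  exact card_le_card (filter_subset_filter _ hST)

theorem outdegreeIn_eq_zero_iff : outdegreeIn G S v = 0 ↔ ∀ w ∈ S, ¬ G.Adj v w := by
  classical
  rw [outdegreeIn, card_eq_zero, filter_eq_empty_iff]

theorem outdegreeIn_add_compl [Fintype V] [DecidableEq V] (v : V) :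
    outdegreeIn G S v + outdegreeIn G Sᶜ v = outdegreeIn G univ v := by
  classical
  rw [outdegreeIn, outdegreeIn, outdegreeIn, ← card_union_of_disjoint, ← filter_union, union_compl]
  exact disjoint_filter_filter disjoint_compl_right

theorem outdegreeIn_lt_card (hv : ¬ G.Adj v v) (hvS : v ∈ S) : outdegreeIn G S v < #S := by
  classical
  exact card_lt_card (filter_ssubset.mpr ⟨v, hvS, hv⟩)

theorem adj_of_card_le_outdegreeIn (hu : ¬ G.Adj u u) (hout : #S ≤ outdegreeIn G S u + 1)
    (huS : u ∈ S) (hvS : v ∈ S) (huv : u ≠ v) : G.Adj u v := by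
  classical
  have hsub : {w ∈ S | G.Adj u w} ⊆ S.erase u := fun w hw => by
    rw [mem_filter] at hw
    exact mem_erase.mpr ⟨by rintro rfl; exact hu hw.2, hw.1⟩
  have heq : {w ∈ S | G.Adj u w} = S.erase u :=
    eq_of_subset_of_card_le hsub (by rw [card_erase_of_mem huS]; exact Nat.sub_le_of_le_add hout)
  exact (mem_filter.mp (heq ▸ mem_erase.mpr ⟨huv.symm, hvS⟩)).2

theorem two_mul_sum_outdegreeIn_le (hG : ∀ v, ¬ G.Adj v v) :
    2 * ∑ v ∈ S, outdegreeIn G S v ≤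
      ∑ v ∈ S, outdegreeIn (symmetricPart G) S v + #S * (#S - 1) := by
  classical
  have hin : ∑ v ∈ S, outdegreeIn G S v = ∑ v ∈ S, #{u ∈ S | G.Adj u v} :=
    sum_card_bipartiteAbove_eq_sum_card_bipartiteBelow G.Adj
  have hvertex (v : V) (hv : v ∈ S) : outdegreeIn G S v + #{u ∈ S | G.Adj u v} ≤
      outdegreeIn (symmetricPart G) S v + (#S - 1) := by
    have hunion : {w ∈ S | G.Adj v w} ∪ {u ∈ S | G.Adj u v} ⊆ S.erase v := fun w hw => by
      rw [← filter_or, mem_filter] at hw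
      refine mem_erase.mpr ⟨?_, hw.1⟩
      rintro rfl
      exact hw.2.elim (hG w) (hG w)
    have hinter : #({w ∈ S | G.Adj v w} ∩ {u ∈ S | G.Adj u v}) =
        outdegreeIn (symmetricPart G) S v := by
      rw [← filter_and, outdegreeIn]
      congr
    rw [outdegreeIn, ← card_union_add_card_inter, hinter, add_comm, ← card_erase_of_mem hv]
    exact Nat.add_le_add_left (card_le_card hunion) _
  calc 2 * ∑ v ∈ S, outdegreeIn G S v
      = ∑ v ∈ S, (outdegreeIn G S v + #{u ∈ S | G.Adj u v}) := by
        rw [sum_add_distrib, ← hin, two_mul]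
    _ ≤ ∑ v ∈ S, (outdegreeIn (symmetricPart G) S v + (#S - 1)) := sum_le_sum hvertex
    _ = _ := by rw [sum_add_distrib, sum_const, smul_eq_mul]

end Outdegree

section Acyclic

variable {s t : Set V} {u v : V}

theorem isAcyclic_induce_iff : (G.induce s).IsAcyclic ↔
    ∀ (l : ℕ) (c : Fin l → V), 0 < l → Function.Injective c → (∀ i, c i ∈ s) →
      ¬ ∀ i, G.Adj (c i) (c (finRotate l i)) := by
  constructor
  · intro h l c hl hc hs hadj
    exact h l (fun i => ⟨c i, hs i⟩) hl (fun i j hij => hc (congrArg Subtype.val hij)) hadj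
  · intro h l c hl hc hadj
    exact h l (fun i => c i) hl (Subtype.val_injective.comp hc) (fun i => (c i).2) hadj

theorem isAcyclic_of_injective {W : Type*} {D : Digraph W} (hG : G.IsAcyclic) {f : W → V}
    (hf : Function.Injective f) (hadj : ∀ a b, D.Adj a b → G.Adj (f a) (f b)) : D.IsAcyclic :=
  fun l c hl hc h => hG l (f ∘ c) hl (hf.comp hc) fun i => hadj _ _ (h i)

theorem isAcyclic_induce_mono (hst : s ⊆ t) (ht : (G.induce t).IsAcyclic) :
    (G.induce s).IsAcyclic :=
  isAcyclic_of_injective ht (Set.inclusion_injective hst) fun _ _ h => h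

theorem isAcyclic_of_forall_lt {α : Type*} [LinearOrder α] (f : V → α)
    (hf : ∀ u v, G.Adj u v → f u < f v) : G.IsAcyclic := by
  intro l c hl _ hadj
  have : Nonempty (Fin l) := ⟨⟨0, hl⟩⟩
  obtain ⟨i, hi⟩ := Finite.exists_max (f ∘ c)
  exact (hf _ _ (hadj i)).not_ge (hi _)

theorem isAcyclic_induce_of_subsingleton (hG : ∀ v, ¬ G.Adj v v) (hs : s.Subsingleton) :
    (G.induce s).IsAcyclic := by
  refine isAcyclic_induce_iff.mpr fun l c hl _ hc hadj => ?_
  have hloop := hadj ⟨0, hl⟩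
  rw [hs (hc (finRotate l ⟨0, hl⟩)) (hc ⟨0, hl⟩)] at hloop
  exact hG _ hloop

theorem isAcyclic_induce_insert (hs : (G.induce s).IsAcyclic)
    (hv : ∀ w ∈ insert v s, ¬ G.Adj v w) : (G.induce (insert v s)).IsAcyclic := by
  rw [isAcyclic_induce_iff] at hs ⊢
  refine fun l c hl hc hmem hadj => hs l c hl hc (fun i => (hmem i).resolve_left ?_) hadj
  rintro rfl
  exact hv _ (hmem (finRotate l i)) (hadj i)

theorem isAcyclic_induce_insert_source (hs : (G.induce s).IsAcyclic)
    (hv : ∀ w ∈ insert v s, ¬ G.Adj w v) : (G.induce (insert v s)).IsAcyclic := by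
  rw [isAcyclic_induce_iff] at hs ⊢
  refine fun l c hl hc hmem hadj => hs l c hl hc (fun i => (hmem i).resolve_left ?_) hadj
  rintro rfl
  have harc := hadj ((finRotate l).symm i)
  rw [Equiv.apply_symm_apply] at harc
  exact hv _ (hmem _) harc

theorem finRotate_finRotate_of_le_two {l : ℕ} (hl : l ≤ 2) (i : Fin l) :
    finRotate l (finRotate l i) = i := by
  interval_cases l <;> fin_cases i <;> rfl

theorem isAcyclic_induce_of_card_le_two {T : Finset V} (hT : #T ≤ 2)
    (hasymm : ∀ u ∈ T, ∀ v ∈ T, G.Adj u v → ¬ G.Adj v u) : (G.induce (T : Set V)).IsAcyclic := by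
  refine isAcyclic_induce_iff.mpr fun l c hl hc hmem hadj => ?_
  have hl2 : l ≤ 2 := by
    simpa using (card_le_card_of_injOn (s := univ) c (fun i _ => hmem i) hc.injOn).trans hT
  have hback := hadj (finRotate l ⟨0, hl⟩)
  rw [finRotate_finRotate_of_le_two hl2] at hback
  exact hasymm _ (hmem _) _ (hmem _) (hadj ⟨0, hl⟩) hback

theorem not_isAcyclic_of_digon (huv : u ≠ v) (h : G.Adj u v) (h' : G.Adj v u) :
    ¬ G.IsAcyclic := by
  intro hG
  refine hG 2 ![u, v] two_pos ?_ fun i => ?_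
  · intro i j
    fin_cases i <;> fin_cases j <;> simp [huv, huv.symm]
  · fin_cases i <;> simpa

end Acyclic

/-- The vertices of `S` can be coloured with `k` colours so that every colour class induces an
acyclic subdigraph. The colouring is defined on all of `V`; its values outside `S` are junk. -/
def ColorableOn (G : Digraph V) (S : Set V) (k : ℕ) : Prop :=
  ∃ f : V → Fin k, ∀ i, (G.induce (S ∩ f ⁻¹' {i})).IsAcyclic

/-- `S` is a minimal vertex set that cannot be coloured with `k` colours. -/
def IsCritical (G : Digraph V) (k : ℕ) (S : Finset V) : Prop :=
  Minimal (fun T : Finset V => ¬ ColorableOn G T k) S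

section Coloring

variable {k : ℕ} {S : Finset V} {v : V}

/-- Greedy colouring: `v` receives a colour that none of its out-neighbours has, so it is a sink
of its colour class. -/
theorem ColorableOn.insert (hS : ColorableOn G S k) (hv : ¬ G.Adj v v)
    (hout : outdegreeIn G S v < k) : ColorableOn G (insert v (S : Set V)) k := by
  classical
  obtain ⟨f, hf⟩ := hS
  obtain ⟨i, hi⟩ : ∃ i, i ∉ image f {w ∈ S | G.Adj v w} := by
    by_contra! hall
    have hle : k ≤ outdegreeIn G S v := by
      simpa [outdegreeIn] using (card_le_card fun i (_ : i ∈ univ) => hall i).trans card_image_le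
    exact hle.not_gt hout
  refine ⟨Function.update f v i, fun j => ?_⟩
  by_cases hj : j = i
  · subst hj
    refine isAcyclic_induce_mono (t := Insert.insert v ((S : Set V) ∩ f ⁻¹' {j})) ?_
      (isAcyclic_induce_insert (hf j) ?_)
    · rintro w ⟨hw, hwj⟩
      by_cases hwv : w = v
      · exact Or.inl hwv
      · exact Or.inr ⟨hw.resolve_left hwv, by simpa [hwv] using hwj⟩
    · rintro w (rfl | ⟨hw, hwj⟩)
      · exact hv
      · exact fun h => hi (mem_image.mpr ⟨w, mem_filter.mpr ⟨hw, h⟩, hwj⟩)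
  · refine isAcyclic_induce_mono ?_ (hf j)
    rintro w ⟨hw, hwj⟩
    have hwv : w ≠ v := by
      rintro rfl
      exact hj (by simpa using hwj.symm)
    exact ⟨hw.resolve_left hwv, by simpa [hwv] using hwj⟩

theorem colorableOn_two_of_subset_union {r s t : Set V} (hr : r ⊆ s ∪ t)
    (hs : (G.induce s).IsAcyclic) (ht : (G.induce t).IsAcyclic) : ColorableOn G r 2 := by
  classical
  refine ⟨fun w => if w ∈ s then 0 else 1, fun i => ?_⟩
  fin_cases i
  · refine isAcyclic_induce_mono (fun w hw => ?_) hs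
    by_contra hws
    simp [hws] at hw
  · refine isAcyclic_induce_mono (fun w hw => (hr hw.1).resolve_left fun hws => ?_) ht
    simp [hws] at hw

theorem exists_isCritical [Finite V] (h : k < G.dichromaticNumber) :
    ∃ S, IsCritical G k S := by
  cases nonempty_fintype V
  refine exists_minimal_of_wellFoundedLT _ ⟨univ, ?_⟩
  rintro ⟨f, hf⟩
  refine Nat.notMem_of_lt_sInf h ⟨f, fun i => isAcyclic_induce_mono ?_ (hf i)⟩
  exact fun w hw => ⟨mem_coe.mpr (mem_univ w), hw⟩

theorem IsCritical.nonempty (hS : IsCritical G k S) (hk : 0 < k) : S.Nonempty := by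
  rw [nonempty_iff_ne_empty]
  rintro rfl
  refine hS.1 ⟨fun _ => ⟨0, hk⟩, fun i => isAcyclic_induce_iff.mpr fun l c hl _ hc => ?_⟩
  exact absurd (hc ⟨0, hl⟩).1 (by simp)

theorem IsCritical.le_outdegreeIn (hS : IsCritical G k S) (hv : ¬ G.Adj v v) (hvS : v ∈ S) :
    k ≤ outdegreeIn G S v := by
  classical
  by_contra! hlt
  have herase : ColorableOn G (S.erase v) k := by
    by_contra hnot
    exact notMem_erase v S (hS.2 hnot (erase_subset v S) hvS)
  have hinsert := herase.insert hv ((outdegreeIn_mono (erase_subset v S)).trans_lt hlt)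
  rw [← coe_insert, insert_erase hvS] at hinsert
  exact hS.1 hinsert

end Coloring

section CriticalEnergy

variable {k : ℕ} {S : Finset V}

theorem card_mul_sq_le_energyOn (hout : ∀ v ∈ S, k ≤ outdegreeIn G S v) :
    #S * k ^ 2 ≤ energyOn G S := by
  rw [← smul_eq_mul]
  exact card_nsmul_le_sum _ _ _ fun v hv =>
    (Nat.pow_le_pow_left (hout v hv) 2).trans (Nat.le_add_right _ _)

theorem card_mul_le_energyOn (hG : ∀ v, ¬ G.Adj v v) (hout : ∀ v ∈ S, k ≤ outdegreeIn G S v) :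
    #S * (k ^ 2 + 2 * k) ≤ energyOn G S + #S * (#S - 1) := by
  have hsq : #S * k ^ 2 ≤ ∑ v ∈ S, outdegreeIn G S v ^ 2 := by
    rw [← smul_eq_mul]
    exact card_nsmul_le_sum _ _ _ fun v hv => Nat.pow_le_pow_left (hout v hv) 2
  have hlin : #S * k ≤ ∑ v ∈ S, outdegreeIn G S v := by
    rw [← smul_eq_mul]
    exact card_nsmul_le_sum _ _ _ hout
  have hdigons := two_mul_sum_outdegreeIn_le (S := S) hG
  rw [energyOn, sum_add_distrib]
  linarith

theorem colorableOn_two_of_card_eq_five (hS : #S = 5) (hout : ∀ v ∈ S, outdegreeIn G S v = 2)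
    (hasymm : ∀ u ∈ S, ∀ v ∈ S, G.Adj u v → ¬ G.Adj v u) : ColorableOn G S 2 := by
  classical
  obtain ⟨v, hv⟩ : S.Nonempty := card_pos.mp (by omega)
  set N : Finset V := {w ∈ S | G.Adj v w} with hN
  have hvv : ¬ G.Adj v v := fun h => hasymm v hv v hv h h
  have hNS : N ⊆ S := filter_subset _ _
  have hNcard : #N = 2 := hout v hv
  have hvN : v ∉ N := fun h => hvv (mem_filter.mp h).2
  have hrest : #(S \ insert v N) ≤ 2 := by
    rw [card_sdiff_of_subset (insert_subset hv hNS), card_insert_of_notMem hvN]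
    omega
  have hsub : (S : Set V) ⊆ insert v (N : Set V) ∪ (S \ insert v N : Finset V) := by
    rw [← coe_insert, ← coe_union, coe_subset, union_sdiff_self_eq_union]
    exact subset_union_right
  refine colorableOn_two_of_subset_union hsub (isAcyclic_induce_insert_source ?_ ?_) ?_
  · exact isAcyclic_induce_of_card_le_two hNcard.le fun u hu w hw => hasymm u (hNS hu) w (hNS hw)
  · rintro w (rfl | hw)
    · exact hvv
    · exact hasymm v hv w (hNS hw) (mem_filter.mp hw).2
  · exact isAcyclic_induce_of_card_le_two hrest fun u hu w hw =>
      hasymm u (mem_sdiff.mp hu).1 w (mem_sdiff.mp hw).1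

theorem colorableOn_two_of_energyOn_le (hS : #S = 5) (hout : ∀ v ∈ S, 2 ≤ outdegreeIn G S v)
    (henergy : energyOn G S ≤ 20) : ColorableOn G S 2 := by
  have hle (v : V) (hv : v ∈ S) :
      4 ≤ outdegreeIn G S v ^ 2 + outdegreeIn (symmetricPart G) S v :=
    (Nat.pow_le_pow_left (hout v hv) 2).trans (Nat.le_add_right _ _)
  have htotal : ∑ _v ∈ S, 4 = energyOn G S :=
    le_antisymm (sum_le_sum hle) (henergy.trans_eq (by rw [sum_const, hS]; rfl))
  have hpointwise := (sum_eq_sum_iff_of_le hle).mp htotal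
  refine colorableOn_two_of_card_eq_five hS (fun v hv => ?_) fun u hu v hv huv hvu => ?_
  · nlinarith [hpointwise v hv, hout v hv]
  · have hno : outdegreeIn (symmetricPart G) S u = 0 := by
      nlinarith [hpointwise u hu, hout u hu]
    exact outdegreeIn_eq_zero_iff.mp hno v hv ⟨huv, hvu⟩

theorem lt_energyOn_of_not_colorableOn (hG : ∀ v, ¬ G.Adj v v) (hk : 2 ≤ k)
    (hS : ¬ ColorableOn G S k) (hout : ∀ v ∈ S, k ≤ outdegreeIn G S v) (hcard : k + 1 < #S) :
    #S + (k + 1) ^ 3 < energyOn G S + (k + 1) ^ 2 + (k + 1) := by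
  have hsq := card_mul_sq_le_energyOn hout
  obtain hsmall | hlarge : #S = k + 2 ∨ k + 3 ≤ #S := by omega
  · have hdigons := card_mul_le_energyOn hG hout
    rw [hsmall] at hdigons ⊢
    have hpred : k + 2 - 1 = k + 1 := rfl
    rw [hpred] at hdigons
    nlinarith
  · by_contra! hle
    obtain ⟨m, hm⟩ := Nat.exists_eq_add_of_le hlarge
    obtain ⟨j, rfl⟩ := Nat.exists_eq_add_of_le hk
    rw [hm] at hsq hle
    have hexcess : j * (j + 3) + m * (j ^ 2 + 4 * j + 3) = 0 := by nlinarith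
    obtain ⟨rfl, rfl⟩ : j = 0 ∧ m = 0 := by simpa using hexcess
    exact hS (colorableOn_two_of_energyOn_le hm hout (by linarith))

end CriticalEnergy

section Isomorphism

variable {W : Type*} {D : Digraph W}

theorem outdegreeIn_map {f : W ↪ V} (hf : ∀ i j, G.Adj (f i) (f j) ↔ D.Adj i j) (T : Finset W)
    (i : W) : outdegreeIn G (T.map f) (f i) = outdegreeIn D T i := by
  classical
  rw [outdegreeIn, outdegreeIn, filter_map, card_map]
  simp only [Function.comp_def, hf]

theorem energyOn_map {f : W ↪ V} (hf : ∀ i j, G.Adj (f i) (f j) ↔ D.Adj i j) (T : Finset W) :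
    energyOn G (T.map f) = energyOn D T := by
  have hsymm (i j : W) : (symmetricPart G).Adj (f i) (f j) ↔ (symmetricPart D).Adj i j :=
    and_congr (hf i j) (hf j i)
  rw [energyOn, energyOn, sum_map]
  simp only [outdegreeIn_map hf, outdegreeIn_map hsymm]

theorem energyOn_eq_of_isIsomorphic [Fintype V] [Fintype W] (h : G.IsIsomorphic D) :
    energyOn G univ = energyOn D univ := by
  obtain ⟨φ⟩ := h
  rw [← map_univ_equiv φ.toEquiv.symm]
  exact energyOn_map (fun _ _ => φ.symm.map_rel_iff) univ

theorem energyOn_eq_of_isIsomorphic_induce [Fintype W] {S : Finset V}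
    (h : (G.induce S).IsIsomorphic D) : energyOn G S = energyOn D univ := by
  rw [← energyOn_eq_of_isIsomorphic h, ← energyOn_map (G := G) (D := G.induce S)
    (f := .subtype (· ∈ (S : Set V))) (fun _ _ => Iff.rfl)]
  congr 1
  ext v
  simp

end Isomorphism

section CompleteDigraph

theorem isIsomorphic_bidirected_top {r : ℕ} (hcard : Nat.card V = r) (hr : 0 < r)
    (hG : ∀ u v, G.Adj u v ↔ u ≠ v) :
    G.IsIsomorphic (bidirected (⊤ : SimpleGraph (Fin r))) := by
  have : Finite V := Nat.finite_of_card_ne_zero (hcard ▸ hr.ne')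
  let e := Finite.equivFinOfCardEq hcard
  exact ⟨e, fun {u v} => (e.injective.ne_iff (x := u)).trans (hG u v).symm⟩

theorem energyOn_bidirected_top (r : ℕ) :
    energyOn (bidirected (⊤ : SimpleGraph (Fin r))) univ + r ^ 2 + r = r + r ^ 3 := by
  have hout (D : Digraph (Fin r)) (hD : ∀ i j, D.Adj i j ↔ i ≠ j) (i : Fin r) :
      outdegreeIn D univ i + 1 = r := by
    classical
    have hN : ({j ∈ univ | D.Adj i j} : Finset (Fin r)) = univ.erase i := by
      ext j
      simp [hD, eq_comm]
    rw [outdegreeIn, hN, card_erase_add_one (mem_univ i), card_univ, Fintype.card_fin]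
  cases r with
  | zero => rfl
  | succ k =>
    have hdeg (i : Fin (k + 1)) :
        outdegreeIn (bidirected (⊤ : SimpleGraph (Fin (k + 1)))) univ i = k :=
      Nat.succ_injective (hout _ (fun _ _ => Iff.rfl) i)
    have hdigons (i : Fin (k + 1)) :
        outdegreeIn (symmetricPart (bidirected (⊤ : SimpleGraph (Fin (k + 1))))) univ i = k :=
      Nat.succ_injective (hout (symmetricPart _) (fun _ _ => ⟨And.left, fun h => ⟨h, h.symm⟩⟩) i)
    rw [energyOn]
    simp only [hdeg, hdigons, sum_const, card_univ, Fintype.card_fin, smul_eq_mul]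
    ring

end CompleteDigraph

section DirectedCycle

theorem directedCycle_two : directedCycle 2 = bidirected ⊤ := by
  ext i j
  fin_cases i <;> fin_cases j <;> simp [directedCycle, bidirected]

theorem finRotate_finRotate_ne {l : ℕ} (hl : 3 ≤ l) (i : Fin l) :
    finRotate l (finRotate l i) ≠ i := by
  obtain ⟨m, rfl⟩ := Nat.exists_eq_add_of_le' hl
  rw [finRotate_apply, finRotate_apply, add_assoc, Ne, add_eq_left]
  exact Fin.ne_of_val_ne (by simp [Fin.val_add, Nat.mod_eq_of_lt (show 2 < m + 3 by omega)])

theorem energyOn_directedCycle {l : ℕ} (hl : 3 ≤ l) : energyOn (directedCycle l) univ = l := by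
  classical
  have hdeg (i : Fin l) : outdegreeIn (directedCycle l) univ i = 1 :=
    card_eq_one.mpr ⟨finRotate l i, by ext j; simp [directedCycle, eq_comm]⟩
  have hdigons (i : Fin l) : outdegreeIn (symmetricPart (directedCycle l)) univ i = 0 := by
    refine outdegreeIn_eq_zero_iff.mpr fun j _ hij => finRotate_finRotate_ne hl i ?_
    rw [show finRotate l i = j from hij.1]
    exact hij.2
  rw [energyOn]
  simp [hdeg, hdigons]

end DirectedCycle

section CriticalCore

variable {k : ℕ} {S : Finset V}

theorem isIsomorphic_bidirected_top_of_card_eq (hG : ∀ v, ¬ G.Adj v v)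
    (hout : ∀ v ∈ S, k ≤ outdegreeIn G S v) (hcard : #S = k + 1) :
    (G.induce S).IsIsomorphic (bidirected (⊤ : SimpleGraph (Fin (k + 1)))) := by
  refine isIsomorphic_bidirected_top ?_ k.succ_pos fun u v => ⟨?_, fun huv => ?_⟩
  · rw [Nat.card_coe_set_eq, Set.ncard_coe_finset, hcard]
  · rintro huv rfl
    exact hG u huv
  · exact adj_of_card_le_outdegreeIn (v := v.1) (hG u)
      (hcard.trans_le (Nat.succ_le_succ (hout u u.2))) u.2 v.2 (Subtype.coe_injective.ne huv)

theorem exists_cycle_of_not_colorableOn_one (hS : ¬ ColorableOn G S 1) :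
    ∃ (l : ℕ) (c : Fin l → V), 0 < l ∧ Function.Injective c ∧ (∀ i, c i ∈ S) ∧
      ∀ i, G.Adj (c i) (c (finRotate l i)) := by
  by_contra! hcycle
  refine hS ⟨fun _ => 0, fun i => isAcyclic_induce_iff.mpr fun l c hl hc hmem hadj => ?_⟩
  obtain ⟨i, hi⟩ := hcycle l c hl hc fun i => (hmem i).1
  exact hi (hadj i)

theorem IsCritical.subset_range (hS : IsCritical G 1 S) {l : ℕ} {c : Fin l → V} (hl : 0 < l)
    (hc : Function.Injective c) (hmem : ∀ i, c i ∈ S)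
    (hadj : ∀ i, G.Adj (c i) (c (finRotate l i))) : (S : Set V) ⊆ Set.range c := by
  classical
  have hrange : ¬ ColorableOn G (image c univ) 1 := by
    rintro ⟨f, hf⟩
    refine isAcyclic_induce_iff.mp (hf 0) l c hl hc (fun i => ⟨?_, Subsingleton.elim _ _⟩) hadj
    exact mem_coe.mpr (mem_image_of_mem c (mem_univ i))
  have hsub : S ⊆ image c univ := hS.2 hrange (image_subset_iff.mpr fun i _ => hmem i)
  simpa only [coe_image, coe_univ, Set.image_univ] using coe_subset.mpr hsub

theorem IsCritical.exists_isIsomorphic_directedCycle (hS : IsCritical G 1 S)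
    (hG : ∀ v, ¬ G.Adj v v) (henergy : energyOn G S = #S) :
    ∃ l, 3 ≤ l ∧ (G.induce S).IsIsomorphic (directedCycle l) := by
  have hout (v : V) (hv : v ∈ S) := hS.le_outdegreeIn (hG v) hv
  have hsum : ∑ _v ∈ S, 1 = energyOn G S := by rw [henergy, sum_const, smul_eq_mul, mul_one]
  have hterm := (sum_eq_sum_iff_of_le fun v hv =>
    (Nat.one_le_pow 2 _ (hout v hv)).trans (Nat.le_add_right _ _)).mp hsum
  have hunique {v w w' : V} (hv : v ∈ S) (hw : w ∈ S) (hw' : w' ∈ S) (hvw : G.Adj v w)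
      (hvw' : G.Adj v w') : w = w' := by
    classical
    have hone : outdegreeIn G S v ≤ 1 := by nlinarith [hterm v hv]
    exact card_le_one.mp hone w (mem_filter.mpr ⟨hw, hvw⟩) w' (mem_filter.mpr ⟨hw', hvw'⟩)
  obtain ⟨l, c, hl, hc, hmem, hadj⟩ := exists_cycle_of_not_colorableOn_one hS.1
  have hthree : 3 ≤ l := by
    by_contra! hlt
    have hdigons : outdegreeIn (symmetricPart G) S (c ⟨0, hl⟩) = 0 := by
      nlinarith [hterm _ (hmem ⟨0, hl⟩), hout _ (hmem ⟨0, hl⟩)]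
    have hback := hadj (finRotate l ⟨0, hl⟩)
    rw [finRotate_finRotate_of_le_two (Nat.le_of_lt_succ hlt)] at hback
    exact outdegreeIn_eq_zero_iff.mp hdigons _ (hmem _) ⟨hadj _, hback⟩
  let e : Fin l ≃ (S : Set V) := Equiv.ofBijective (fun i => ⟨c i, hmem i⟩)
    ⟨fun i j hij => hc (congrArg Subtype.val hij), fun v =>
      (hS.subset_range hl hc hmem hadj v.2).imp fun _ => Subtype.ext⟩
  refine ⟨l, hthree, ⟨RelIso.symm ⟨e, fun {i j} => ⟨fun hij => ?_, fun hij => ?_⟩⟩⟩⟩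
  · exact hc (hunique (hmem i) (hmem _) (hmem j) (hadj i) hij)
  · exact (show finRotate l i = j from hij) ▸ hadj i

end CriticalCore

theorem exists_adj_dist_lt {H : SimpleGraph V} (hH : H.Connected) {u v : V} (huv : u ≠ v) :
    ∃ w, H.Adj u w ∧ H.dist w v < H.dist u v := by
  obtain ⟨p, hp⟩ := hH.exists_walk_length_eq_dist u v
  cases p with
  | nil => exact absurd rfl huv
  | cons hadj q =>
    rw [SimpleGraph.Walk.length_cons] at hp
    exact ⟨_, hadj, hp ▸ Nat.lt_succ_of_le (SimpleGraph.dist_le q)⟩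

theorem toSimpleGraphInclusive_adj {u v : V} :
    G.toSimpleGraphInclusive.Adj u v ↔ u ≠ v ∧ (G.Adj u v ∨ G.Adj v u) :=
  SimpleGraph.fromRel_adj _ _ _

/-- Every vertex outside `S` has exactly one out-arc, no arc enters the complement of `S` from `S`,
and no digon meets it: outside of `S`, the digraph is the graph of a function. -/
structure HasFunctionalComplement (G : Digraph V) (S : Set V) : Prop where
  not_adj : ∀ v ∈ S, ∀ w ∉ S, ¬ G.Adj v w
  outdegree_eq : ∀ v ∉ S, G.outdegree v = 1
  asymm : ∀ v ∉ S, ∀ w, G.Adj v w → ¬ G.Adj w v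

section Complement

variable [Fintype V] [DecidableEq V] {S : Finset V}

theorem card_compl_le_sum_outdegreeIn (hG : G.toSimpleGraphInclusive.Connected)
    (hS : S.Nonempty) :
    #Sᶜ ≤ ∑ v ∈ S, outdegreeIn G Sᶜ v + ∑ v ∈ Sᶜ, outdegreeIn G univ v := by
  classical
  obtain ⟨s, hs⟩ := hS
  -- Each vertex outside `S` picks an edge towards `s`; the distance to `s` tells its endpoints
  -- apart, so no edge is picked twice.
  have hnext (v : V) : ∃ w, v ∉ S → G.toSimpleGraphInclusive.Adj v w ∧
      G.toSimpleGraphInclusive.dist w s < G.toSimpleGraphInclusive.dist v s := by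
    by_cases hv : v ∈ S
    · exact ⟨v, fun h => absurd hv h⟩
    · exact (exists_adj_dist_lt hG fun h : v = s => hv (h ▸ hs)).imp fun _ h _ => h
  choose next hnext using hnext
  have hinj : Set.InjOn (fun v => s(v, next v)) (Sᶜ : Finset V) := by
    intro v hv w hw hvw
    rcases Sym2.eq_iff.mp hvw with ⟨h, -⟩ | ⟨h, h'⟩
    · exact h
    · have hlt := (hnext v (mem_compl.mp hv)).2
      have hgt := (hnext w (mem_compl.mp hw)).2
      rw [h'] at hlt
      rw [← h] at hgt
      exact absurd hlt hgt.asymm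
  let arcsFrom (T : Finset V) (v : V) : Finset (Sym2 V) := {w ∈ T | G.Adj v w}.image (s(v, ·))
  have hcover : image (fun v => s(v, next v)) Sᶜ ⊆
      S.biUnion (arcsFrom Sᶜ) ∪ Sᶜ.biUnion (arcsFrom univ) := by
    refine image_subset_iff.mpr fun v hv => ?_
    rcases (toSimpleGraphInclusive_adj.mp (hnext v (mem_compl.mp hv)).1).2 with h | h
    · exact mem_union_right _ (mem_biUnion.mpr ⟨v, hv, mem_image.mpr
        ⟨next v, by simpa using h, rfl⟩⟩)
    · rw [Sym2.eq_swap, mem_union, mem_biUnion, mem_biUnion]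
      by_cases hw : next v ∈ S
      · exact Or.inl ⟨_, hw, mem_image.mpr ⟨v, mem_filter.mpr ⟨hv, h⟩, rfl⟩⟩
      · exact Or.inr ⟨_, mem_compl.mpr hw, mem_image.mpr ⟨v, by simpa using h, rfl⟩⟩
  rw [← card_image_of_injOn hinj]
  exact (card_le_card hcover).trans <| (card_union_le _ _).trans <| Nat.add_le_add
    (card_biUnion_le.trans (sum_le_sum fun _ _ => card_image_le))
    (card_biUnion_le.trans (sum_le_sum fun _ _ => card_image_le))

/-- A lower bound for the contribution of `v` to the energy of `G` that counts each arc leaving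
`S` or starting outside of `S` just once, instead of squaring outdegrees. -/
noncomputable def linearContribution (G : Digraph V) (S : Finset V) (v : V) : ℕ :=
  if v ∈ S then
    outdegreeIn G S v ^ 2 + outdegreeIn (symmetricPart G) S v + outdegreeIn G Sᶜ v
  else outdegreeIn G univ v

theorem sum_linearContribution : ∑ v, linearContribution G S v =
    energyOn G S + (∑ v ∈ S, outdegreeIn G Sᶜ v + ∑ v ∈ Sᶜ, outdegreeIn G univ v) := by
  have hin : ∑ v ∈ S, linearContribution G S v =
      energyOn G S + ∑ v ∈ S, outdegreeIn G Sᶜ v := by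
    rw [energyOn, ← sum_add_distrib]
    exact sum_congr rfl fun v hv => if_pos hv
  have hout : ∑ v ∈ Sᶜ, linearContribution G S v = ∑ v ∈ Sᶜ, outdegreeIn G univ v :=
    sum_congr rfl fun v hv => if_neg (mem_compl.mp hv)
  rw [← sum_add_sum_compl S, hin, hout, add_assoc]

theorem linearContribution_le (v : V) : linearContribution G S v ≤
    outdegreeIn G univ v ^ 2 + outdegreeIn (symmetricPart G) univ v := by
  rw [linearContribution]
  split_ifs
  · rw [← outdegreeIn_add_compl (S := S), ← outdegreeIn_add_compl (G := symmetricPart G) (S := S)]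
    nlinarith [Nat.le_self_pow two_ne_zero (outdegreeIn G Sᶜ v),
      Nat.zero_le (outdegreeIn G S v * outdegreeIn G Sᶜ v)]
  · exact (Nat.le_self_pow two_ne_zero _).trans (Nat.le_add_right _ _)

theorem energyOn_add_card_compl_le_sum (hG : G.toSimpleGraphInclusive.Connected)
    (hS : S.Nonempty) : energyOn G S + #Sᶜ ≤ ∑ v, linearContribution G S v := by
  rw [sum_linearContribution]
  exact Nat.add_le_add_left (card_compl_le_sum_outdegreeIn hG hS) _

theorem energyOn_add_card_compl_le (hG : G.toSimpleGraphInclusive.Connected) (hS : S.Nonempty) :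
    energyOn G S + #Sᶜ ≤ energyOn G univ :=
  (energyOn_add_card_compl_le_sum hG hS).trans (sum_le_sum fun v _ => linearContribution_le v)

theorem HasFunctionalComplement.of_energyOn_eq (hG : G.toSimpleGraphInclusive.Connected)
    (hS : S.Nonempty) (hout : ∀ v ∈ S, 1 ≤ outdegreeIn G S v)
    (henergy : energyOn G univ = energyOn G S + #Sᶜ) : HasFunctionalComplement G S := by
  have hle := sum_le_sum fun v (_ : v ∈ univ) => linearContribution_le (G := G) (S := S) v
  have hsum : ∑ v, linearContribution G S v = energyOn G S + #Sᶜ :=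
    le_antisymm (hle.trans_eq henergy) (energyOn_add_card_compl_le_sum hG hS)
  have hterm := (sum_eq_sum_iff_of_le fun v _ => linearContribution_le v).mp
    (hsum.trans henergy.symm)
  have hin (v : V) (hv : v ∈ S) : outdegreeIn G Sᶜ v = 0 := by
    have hv' := hterm v (mem_univ v)
    rw [linearContribution, if_pos hv, ← outdegreeIn_add_compl (S := S),
      ← outdegreeIn_add_compl (G := symmetricPart G) (S := S)] at hv'
    nlinarith [hout v hv, Nat.le_self_pow two_ne_zero (outdegreeIn G Sᶜ v)]
  have hoff (v : V) (hv : v ∉ S) :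
      outdegreeIn G univ v ≤ 1 ∧ outdegreeIn (symmetricPart G) univ v = 0 := by
    have hv' := hterm v (mem_univ v)
    rw [linearContribution, if_neg hv] at hv'
    constructor <;> nlinarith
  have hone : ∑ v ∈ Sᶜ, outdegreeIn G univ v = ∑ _v ∈ Sᶜ, 1 := by
    rw [sum_linearContribution, sum_eq_zero hin, zero_add] at hsum
    rw [← card_eq_sum_ones]
    exact Nat.add_left_cancel hsum
  have hdeg := (sum_eq_sum_iff_of_le fun v hv => (hoff v (mem_compl.mp hv)).1).mp hone
  refine ⟨fun v hv w hw => ?_, fun v hv => ?_, fun v hv w hvw hwv => ?_⟩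
  · exact outdegreeIn_eq_zero_iff.mp (hin v hv) w (mem_compl.mpr hw)
  · rw [outdegree_eq_outdegreeIn_univ, hdeg v (mem_compl.mpr hv)]
  · exact outdegreeIn_eq_zero_iff.mp (hoff v hv).2 w (mem_univ w) ⟨hvw, hwv⟩

theorem HasFunctionalComplement.energyOn_eq (h : HasFunctionalComplement G S) :
    energyOn G univ = energyOn G S + #Sᶜ := by
  have hin : ∑ v ∈ S, (outdegreeIn G univ v ^ 2 + outdegreeIn (symmetricPart G) univ v) =
      energyOn G S := by
    refine sum_congr rfl fun v hv => ?_
    have harcs : outdegreeIn G Sᶜ v = 0 :=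
      outdegreeIn_eq_zero_iff.mpr fun w hw => h.not_adj v hv w (mem_compl.mp hw)
    have hdigons : outdegreeIn (symmetricPart G) Sᶜ v = 0 :=
      outdegreeIn_eq_zero_iff.mpr fun w hw hvw => h.not_adj v hv w (mem_compl.mp hw) hvw.1
    rw [← outdegreeIn_add_compl (S := S), harcs, ← outdegreeIn_add_compl (S := S), hdigons,
      add_zero, add_zero]
  have hoff : ∑ v ∈ Sᶜ, (outdegreeIn G univ v ^ 2 + outdegreeIn (symmetricPart G) univ v) =
      #Sᶜ := by
    rw [card_eq_sum_ones]
    refine sum_congr rfl fun v hv => ?_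
    have hdigons : outdegreeIn (symmetricPart G) univ v = 0 :=
      outdegreeIn_eq_zero_iff.mpr fun w _ hvw => h.asymm v (mem_compl.mp hv) w hvw.1 hvw.2
    rw [hdigons, ← outdegree_eq_outdegreeIn_univ, h.outdegree_eq v (mem_compl.mp hv)]
    rfl
  rw [← hin, ← hoff, sum_add_sum_compl, energyOn]

end Complement

section HangingInTrees

variable {S : Set V}

theorem outdegree_eq_zero_iff [Finite V] {v : V} : G.outdegree v = 0 ↔ ∀ w, ¬ G.Adj v w := by
  rw [outdegree, Set.ncard_eq_zero, Set.eq_empty_iff_forall_notMem]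
  rfl

theorem outdegree_eq_one_iff {v : V} : G.outdegree v = 1 ↔ ∃! w, G.Adj v w := by
  simp only [outdegree, Set.ncard_eq_one, ExistsUnique, Set.eq_singleton_iff_unique_mem,
    Set.mem_ofPred_eq]

theorem outdegree_le_one_iff [Finite V] {v : V} :
    G.outdegree v ≤ 1 ↔ ∀ u w, G.Adj v u → G.Adj v w → u = w := by
  rw [outdegree, Set.ncard_le_one]
  exact ⟨fun h u w hu hw => h u hu w hw, fun h u hu w hw => h u w hu hw⟩

theorem toSimpleGraphInclusive_induce (S : Set V) :
    (G.induce S).toSimpleGraphInclusive = G.toSimpleGraphInclusive.induce S := by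
  ext u v
  simp only [SimpleGraph.comap_adj, toSimpleGraphInclusive_adj, induce,
    Function.Embedding.subtype_apply, ne_eq, Subtype.ext_iff]

theorem mem_supp_of_adj {C : G.Component} {u v : V} (hu : u ∈ C.supp)
    (h : G.Adj u v ∨ G.Adj v u) : v ∈ C.supp := by
  by_cases huv : u = v
  · exact huv ▸ hu
  · exact C.mem_supp_of_adj_mem_supp hu (toSimpleGraphInclusive_adj.mpr ⟨huv, h⟩)

theorem outdegree_induce_supp {C : G.Component} (v : C.supp) :
    (G.induce C.supp).outdegree v = G.outdegree v := by
  have himage : {w | G.Adj v w} = Subtype.val '' {w | (G.induce C.supp).Adj v w} := by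
    ext w
    exact ⟨fun h => ⟨⟨w, mem_supp_of_adj v.2 (Or.inl h)⟩, h, rfl⟩, by rintro ⟨x, hx, rfl⟩; exact hx⟩
  rw [outdegree, outdegree, himage, Set.ncard_image_of_injective _ Subtype.val_injective]

theorem isRoot_induce_supp_iff [Finite V] {C : (G.induce Sᶜ).Component} {v : C.supp} :
    ((G.induce Sᶜ).induce C.supp).IsRoot v ↔ ∀ w ∉ S, ¬ G.Adj v w := by
  rw [IsRoot, outdegree_induce_supp, outdegree_eq_zero_iff, Subtype.forall]
  rfl

theorem isTree_of_outdegree_le_one [Finite V] (hG : G.toSimpleGraphInclusive.Connected)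
    (hout : ∀ v, G.outdegree v ≤ 1) {ρ : V} (hρ : G.IsRoot ρ) :
    G.toSimpleGraphInclusive.IsTree := by
  refine SimpleGraph.isTree_iff_connected_and_card.mpr
    ⟨hG, le_antisymm ?_ hG.card_vert_le_card_edgeSet_add_one⟩
  have htail : ∀ e : G.toSimpleGraphInclusive.edgeSet, ∃ x y, G.Adj x y ∧ e.1 = s(x, y) := by
    rintro ⟨e, he⟩
    induction e with
    | h x y =>
      rcases (toSimpleGraphInclusive_adj.mp he).2 with h | h
      · exact ⟨x, y, h, rfl⟩
      · exact ⟨y, x, h, Sym2.eq_swap⟩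
  choose tail head hadj he using htail
  have hne (e) : ρ ≠ tail e := fun h => outdegree_eq_zero_iff.mp hρ _ (h ▸ hadj e)
  -- The root is the tail of no arc, and every other vertex of at most one.
  rw [← Finite.card_option]
  refine Nat.card_le_card_of_injective (fun e => e.elim ρ tail) ?_
  rintro (_ | e) (_ | e') h
  · rfl
  · exact absurd h (hne e')
  · exact absurd h.symm (hne e)
  · have htails : tail e = tail e' := h
    have hheads : head e = head e' :=
      outdegree_le_one_iff.mp (hout (tail e)) _ _ (hadj e) (htails ▸ hadj e')
    rw [Subtype.ext (by rw [he e, he e', htails, hheads] : e.1 = e'.1)]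

theorem exists_adj_core (hG : G.toSimpleGraphInclusive.Connected) (hS : S.Nonempty)
    (C : (G.induce Sᶜ).Component) : ∃ u : C.supp, ∃ s ∈ S, G.Adj u s ∨ G.Adj s u := by
  obtain ⟨s, hs⟩ := hS
  obtain ⟨x, hx⟩ := C.nonempty_supp
  obtain ⟨p⟩ := hG.preconnected x s
  obtain ⟨d, -, ⟨u, hu, hud⟩, hd⟩ := p.exists_boundary_dart (Subtype.val '' C.supp) ⟨x, hx, rfl⟩
    (by rintro ⟨y, -, rfl⟩; exact y.2 hs)
  have hadj := (toSimpleGraphInclusive_adj.mp d.adj).2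
  rw [← hud] at hadj
  refine ⟨⟨u, hu⟩, d.snd, ?_, hadj⟩
  by_contra hdS
  exact hd ⟨⟨d.snd, hdS⟩, mem_supp_of_adj (G := G.induce Sᶜ) hu hadj, rfl⟩

theorem HasFunctionalComplement.adj_unique (h : HasFunctionalComplement G S) {v u w : V}
    (hv : v ∉ S) (hu : G.Adj v u) (hw : G.Adj v w) : u = w :=
  (outdegree_eq_one_iff.mp (h.outdegree_eq v hv)).unique hu hw

theorem HasFunctionalComplement.exists_isRoot [Finite V] (h : HasFunctionalComplement G S)
    (hG : G.toSimpleGraphInclusive.Connected) (hS : S.Nonempty) (C : (G.induce Sᶜ).Component) :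
    ∃ ρ, ((G.induce Sᶜ).induce C.supp).IsRoot ρ := by
  obtain ⟨u, s, hs, hus⟩ := exists_adj_core hG hS C
  refine ⟨u, isRoot_induce_supp_iff.mpr fun w hw huw => ?_⟩
  have hus' : G.Adj u s := hus.resolve_right (h.not_adj s hs u u.1.2)
  exact hw (h.adj_unique u.1.2 hus' huw ▸ hs)

theorem HasFunctionalComplement.hasHangingInTrees [Finite V] (h : HasFunctionalComplement G S)
    (hG : G.toSimpleGraphInclusive.Connected) (hS : S.Nonempty) : G.HasHangingInTrees S := by
  intro C
  have hout (x : C.supp) : ((G.induce Sᶜ).induce C.supp).outdegree x ≤ 1 :=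
    outdegree_le_one_iff.mpr fun a b ha hb =>
      Subtype.ext (Subtype.ext (h.adj_unique x.1.2 ha hb))
  have hC : ((G.induce Sᶜ).induce C.supp).toSimpleGraphInclusive.Connected := by
    rw [toSimpleGraphInclusive_induce (G := G.induce Sᶜ) C.supp]
    exact C.connected_toSimpleGraph
  obtain ⟨ρ, hρ⟩ := h.exists_isRoot hG hS C
  refine ⟨⟨⟨isTree_of_outdegree_le_one hC hout hρ, fun u v huv => h.asymm u u.1.2 v huv⟩, hout⟩,
    fun v => ⟨fun hv => ?_, fun hv w hw hvw => ?_, fun w hw => h.not_adj w hw v v.1.2⟩⟩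
  · obtain ⟨w, hw, hunique⟩ := outdegree_eq_one_iff.mp (h.outdegree_eq v v.1.2)
    refine ⟨w, ⟨?_, hw⟩, fun y hy => hunique y hy.2⟩
    by_contra hwS
    exact isRoot_induce_supp_iff.mp hv w hwS hw
  · exact hv (isRoot_induce_supp_iff.mpr fun y hy hvy => hy (h.adj_unique v.1.2 hvw hvy ▸ hw))

theorem outdegree_eq_one_of_hasHangingInTrees [Finite V] (h : G.HasHangingInTrees S) {v : V}
    (hv : v ∉ S) : G.outdegree v = 1 := by
  obtain ⟨C, hC⟩ : ∃ C : (G.induce Sᶜ).Component, (⟨v, hv⟩ : (Sᶜ : Set V)) ∈ C.supp :=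
    ⟨_, SimpleGraph.ConnectedComponent.connectedComponentMk_mem⟩
  obtain ⟨hroot, hnonroot, -⟩ := (h C).2 ⟨_, hC⟩
  rw [outdegree_eq_one_iff]
  by_cases hv' : ((G.induce Sᶜ).induce C.supp).IsRoot ⟨_, hC⟩
  · obtain ⟨w, ⟨-, hw⟩, hunique⟩ := hroot hv'
    refine ⟨w, hw, fun y hy => hunique y ⟨?_, hy⟩⟩
    by_contra hyS
    exact isRoot_induce_supp_iff.mp hv' y hyS hy
  · have hone := le_antisymm ((h C).1.2 ⟨_, hC⟩) (Nat.one_le_iff_ne_zero.mpr hv')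
    rw [outdegree_induce_supp] at hone
    obtain ⟨w, hw, hunique⟩ := outdegree_eq_one_iff.mp hone
    refine ⟨w, hw, fun y hy => ?_⟩
    have hyS : y ∉ S := fun hyS => hnonroot hv' y hyS hy
    exact congrArg Subtype.val (hunique ⟨y, hyS⟩ hy)

theorem hasFunctionalComplement_of_hasHangingInTrees [Finite V] (h : G.HasHangingInTrees S) :
    HasFunctionalComplement G S := by
  have hcomponent (v : V) (hv : v ∉ S) :
      ∃ C : (G.induce Sᶜ).Component, (⟨v, hv⟩ : (Sᶜ : Set V)) ∈ C.supp :=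
    ⟨_, SimpleGraph.ConnectedComponent.connectedComponentMk_mem⟩
  refine ⟨fun u hu v hv => ?_, fun _ => outdegree_eq_one_of_hasHangingInTrees h,
    fun v hv w hvw hwv => ?_⟩
  · obtain ⟨C, hC⟩ := hcomponent v hv
    exact ((h C).2 ⟨_, hC⟩).2.2 u hu
  · obtain ⟨C, hC⟩ := hcomponent v hv
    by_cases hw : w ∈ S
    · exact ((h C).2 ⟨_, hC⟩).2.2 w hw hwv
    · have hwC : (⟨w, hw⟩ : (Sᶜ : Set V)) ∈ C.supp :=
        mem_supp_of_adj (G := G.induce Sᶜ) hC (Or.inl hvw)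
      exact (h C).1.1.2 ⟨_, hC⟩ ⟨_, hwC⟩ hvw hwv

end HangingInTrees

section Pendants

variable {W : Type*} {D : Digraph W} {f : W ↪ V} {w₀ : W}

/-- The copy of `D` in `V` along `f`, together with one arc to the copy of `w₀` from each vertex
that is not in the range of `f`. These digraphs attain the bounds. -/
def hangPendants (D : Digraph W) (f : W ↪ V) (w₀ : W) : Digraph V where
  Adj u v := (∃ i j, D.Adj i j ∧ f i = u ∧ f j = v) ∨ u ∉ Set.range f ∧ v = f w₀

theorem hangPendants_adj_apply {i j : W} : (hangPendants D f w₀).Adj (f i) (f j) ↔ D.Adj i j := by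
  simp [hangPendants]

theorem hangPendants_adj_of_notMem_range {u v : V} (hu : u ∉ Set.range f) :
    (hangPendants D f w₀).Adj u v ↔ v = f w₀ := by
  refine ⟨?_, fun hv => Or.inr ⟨hu, hv⟩⟩
  rintro (⟨i, j, -, rfl, -⟩ | ⟨-, hv⟩)
  · exact absurd ⟨i, rfl⟩ hu
  · exact hv

theorem mem_range_of_hangPendants_adj {u v : V} (h : (hangPendants D f w₀).Adj u v) :
    v ∈ Set.range f := by
  obtain ⟨-, j, -, -, rfl⟩ | ⟨-, rfl⟩ := h
  exacts [⟨j, rfl⟩, ⟨w₀, rfl⟩]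

theorem not_hangPendants_adj_self (hD : ∀ i, ¬ D.Adj i i) (v : V) :
    ¬ (hangPendants D f w₀).Adj v v := by
  intro h
  obtain ⟨i, rfl⟩ := mem_range_of_hangPendants_adj h
  exact hD i (hangPendants_adj_apply.mp h)

theorem connected_hangPendants (hD : D.toSimpleGraphInclusive.Connected) :
    (hangPendants D f w₀).toSimpleGraphInclusive.Connected := by
  refine SimpleGraph.connected_iff_exists_forall_reachable _ |>.mpr ⟨f w₀, fun v => ?_⟩
  by_cases hv : v ∈ Set.range f
  · obtain ⟨i, rfl⟩ := hv
    let φ : D.toSimpleGraphInclusive →g (hangPendants D f w₀).toSimpleGraphInclusive :=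
      ⟨f, fun {a b} h => toSimpleGraphInclusive_adj.mpr
        ((toSimpleGraphInclusive_adj.mp h).imp f.injective.ne
          (Or.imp hangPendants_adj_apply.mpr hangPendants_adj_apply.mpr))⟩
    exact (hD.preconnected w₀ i).map φ
  · refine (SimpleGraph.Adj.reachable (toSimpleGraphInclusive_adj.mpr ⟨?_, Or.inl ?_⟩)).symm
    · rintro rfl
      exact hv ⟨w₀, rfl⟩
    · exact (hangPendants_adj_of_notMem_range hv).mpr rfl

theorem hasFunctionalComplement_hangPendants :
    HasFunctionalComplement (hangPendants D f w₀) (Set.range f) where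
  not_adj _ _ _ hv h := hv (mem_range_of_hangPendants_adj h)
  outdegree_eq _ hv := outdegree_eq_one_iff.mpr
    ⟨f w₀, (hangPendants_adj_of_notMem_range hv).mpr rfl,
      fun _ hw => (hangPendants_adj_of_notMem_range hv).mp hw⟩
  asymm _ hv _ _ h := hv (mem_range_of_hangPendants_adj h)

theorem isIsomorphic_induce_range_hangPendants :
    ((hangPendants D f w₀).induce (Set.range f)).IsIsomorphic D :=
  ⟨RelIso.symm ⟨Equiv.ofInjective f f.injective, hangPendants_adj_apply⟩⟩

theorem dichromaticNumber_hangPendants :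
    (hangPendants D f w₀).dichromaticNumber = D.dichromaticNumber := by
  refine congrArg sInf (Set.ext fun r => ⟨?_, ?_⟩)
  · rintro ⟨g, hg⟩
    exact ⟨g ∘ f, fun i => isAcyclic_of_injective (hg i) (f := fun w => ⟨f w.1, w.2⟩)
      (fun a b hab => Subtype.ext (f.injective (congrArg Subtype.val hab)))
      fun _ _ h => hangPendants_adj_apply.mpr h⟩
  · rintro ⟨g, hg⟩
    refine ⟨Function.extend f g fun _ => g w₀, fun i => isAcyclic_induce_iff.mpr ?_⟩
    intro l c hl hc hmem hadj
    -- Pendants have no in-arcs, so a directed cycle avoids them.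
    have hrange (j : Fin l) : ∃ w, f w = c j := by
      have h := mem_range_of_hangPendants_adj (hadj ((finRotate l).symm j))
      rwa [Equiv.apply_symm_apply] at h
    choose d hd using hrange
    refine isAcyclic_induce_iff.mp (hg i) l d hl (fun a b hab => hc ?_) (fun j => ?_) fun j => ?_
    · rw [← hd a, ← hd b, hab]
    · have h := hmem j
      rwa [← hd j, Set.mem_preimage, f.injective.extend_apply] at h
    · have h := hadj j
      rwa [← hd, ← hd, hangPendants_adj_apply] at h

theorem exists_mem_withDichromaticNumber [Fintype V] [Fintype W] (hD : ∀ i, ¬ D.Adj i i)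
    (hconn : D.toSimpleGraphInclusive.Connected) (hcard : Fintype.card W ≤ Fintype.card V) :
    ∃ G ∈ withDichromaticNumber V D.dichromaticNumber,
      ∃ S, (G.induce S).IsIsomorphic D ∧ G.HasHangingInTrees S := by
  obtain ⟨f⟩ := Function.Embedding.nonempty_of_card_le hcard
  obtain ⟨w₀⟩ := hconn.nonempty
  have hconn' := connected_hangPendants (f := f) (w₀ := w₀) hconn
  refine ⟨hangPendants D f w₀, ⟨not_hangPendants_adj_self hD, hconn',
    dichromaticNumber_hangPendants⟩, Set.range f, isIsomorphic_induce_range_hangPendants, ?_⟩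
  exact hasFunctionalComplement_hangPendants.hasHangingInTrees hconn' ⟨f w₀, w₀, rfl⟩

end Pendants

section DichromaticNumber

theorem dichromaticNumber_eq {r : ℕ} {f : V → Fin r} (hf : G.IsAcyclicColoring f)
    (hmin : ∀ (k : ℕ) (g : V → Fin k), G.IsAcyclicColoring g → r ≤ k) :
    G.dichromaticNumber = r :=
  le_antisymm (Nat.sInf_le ⟨f, hf⟩) (le_csInf ⟨r, f, hf⟩ fun k ⟨g, hg⟩ => hmin k g hg)

theorem dichromaticNumber_bidirected_top (r : ℕ) :
    (bidirected (⊤ : SimpleGraph (Fin r))).dichromaticNumber = r := by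
  refine dichromaticNumber_eq (f := id) (fun i => ?_) fun k g hg => ?_
  · refine isAcyclic_induce_of_subsingleton (fun _ => (⊤ : SimpleGraph (Fin r)).irrefl) ?_
    exact fun a ha b hb => ha.trans hb.symm
  · have hinj : Function.Injective g := fun i j hij => by
      by_contra hne
      exact not_isAcyclic_of_digon (u := ⟨i, rfl⟩) (v := ⟨j, hij.symm⟩)
        (fun h => hne (congrArg Subtype.val h)) hne (Ne.symm hne) (hg (g i))
    simpa using Fintype.card_le_of_injective g hinj

theorem connected_bidirected_top {r : ℕ} (hr : 0 < r) :
    (bidirected (⊤ : SimpleGraph (Fin r))).toSimpleGraphInclusive.Connected := by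
  have : Nonempty (Fin r) := ⟨⟨0, hr⟩⟩
  exact SimpleGraph.connected_top.mono fun i j h => toSimpleGraphInclusive_adj.mpr ⟨h, Or.inl h⟩

theorem not_directedCycle_adj_self {l : ℕ} (hl : 2 ≤ l) (i : Fin l) :
    ¬ (directedCycle l).Adj i i :=
  Equiv.Perm.mem_support.mp (support_finRotate_of_le hl ▸ mem_univ i)

theorem connected_directedCycle {l : ℕ} (hl : 2 ≤ l) :
    (directedCycle l).toSimpleGraphInclusive.Connected := by
  obtain ⟨m, rfl⟩ := Nat.exists_eq_add_of_le' hl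
  refine SimpleGraph.cycleGraph_connected.mono fun i j hij => ?_
  refine toSimpleGraphInclusive_adj.mpr ⟨hij.ne, ?_⟩
  simp only [directedCycle, finRotate_apply]
  exact (SimpleGraph.cycleGraph_adj.mp hij).symm.imp (fun h => by rw [← h]; abel) fun h => by
    rw [← h]; abel

theorem dichromaticNumber_directedCycle {l : ℕ} (hl : 2 ≤ l) :
    (directedCycle l).dichromaticNumber = 2 := by
  obtain ⟨m, rfl⟩ := Nat.exists_eq_add_of_le' hl
  let f (i : Fin (m + 2)) : Fin 2 := if i = 0 then 0 else 1
  have hzero (i : Fin (m + 2)) : f i = 0 ↔ i = 0 := by simp [f]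
  refine dichromaticNumber_eq (f := f) (fun c => ?_) fun k g hg => ?_
  · obtain rfl | hc := eq_or_ne c 0
    · refine isAcyclic_induce_of_subsingleton (not_directedCycle_adj_self hl) fun i hi j hj => ?_
      exact ((hzero i).mp hi).trans ((hzero j).mp hj).symm
    -- Without the vertex `0`, every arc goes from `i` to `i + 1` in the order of `Fin`.
    · refine isAcyclic_of_forall_lt Subtype.val ?_
      rintro ⟨i, -⟩ ⟨_, hj⟩ rfl
      refine (lt_finRotate_iff_ne_last i).mpr ?_
      rintro rfl
      exact hc (hj.symm.trans ((hzero _).mpr finRotate_last))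
  · by_contra! hk
    have : Subsingleton (Fin k) := Fin.subsingleton_iff_le_one.mpr (Nat.le_of_lt_succ hk)
    exact isAcyclic_induce_iff.mp (hg (g 0)) (m + 2) id (by omega) Function.injective_id
      (fun _ => Subsingleton.elim _ _) fun _ => rfl

theorem exists_mem_directedCycle [Fintype V] {l : ℕ} (hl : 2 ≤ l) (hcard : l ≤ Fintype.card V) :
    ∃ G ∈ withDichromaticNumber V 2,
      ∃ S, (G.induce S).IsIsomorphic (directedCycle l) ∧ G.HasHangingInTrees S := by
  simpa only [dichromaticNumber_directedCycle hl] using exists_mem_withDichromaticNumber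
    (not_directedCycle_adj_self hl) (connected_directedCycle hl)
    ((Fintype.card_fin l).trans_le hcard)

theorem exists_mem_bidirected_top [Fintype V] {r : ℕ} (hr : 0 < r) (hcard : r ≤ Fintype.card V) :
    ∃ G ∈ withDichromaticNumber V r,
      ∃ S, (G.induce S).IsIsomorphic (bidirected (⊤ : SimpleGraph (Fin r))) ∧
        G.HasHangingInTrees S := by
  simpa only [dichromaticNumber_bidirected_top r] using exists_mem_withDichromaticNumber
    (fun _ => (⊤ : SimpleGraph (Fin r)).irrefl) (connected_bidirected_top hr)
    ((Fintype.card_fin r).trans_le hcard)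

end DichromaticNumber

section Extremal

theorem energyOn_add_card_of_hasHangingInTrees [Fintype V] {W : Type*} [Fintype W] {D : Digraph W}
    {S : Set V} (hiso : (G.induce S).IsIsomorphic D) (htrees : G.HasHangingInTrees S) :
    energyOn G univ + Fintype.card W = energyOn D univ + Fintype.card V := by
  classical
  obtain ⟨T, rfl⟩ := S.toFinite.exists_finset_coe
  have hcard : #T = Fintype.card W := by
    obtain ⟨φ⟩ := hiso
    rw [← Nat.card_eq_fintype_card, ← Nat.card_congr φ.toEquiv, Nat.card_coe_set_eq,
      Set.ncard_coe_finset]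
  rw [(hasFunctionalComplement_of_hasHangingInTrees htrees).energyOn_eq,
    energyOn_eq_of_isIsomorphic_induce hiso, ← hcard, add_assoc, add_comm #Tᶜ, card_add_card_compl]

variable {k : ℕ}

theorem IsCritical.card_le_energyOn {S : Finset V} (hS : IsCritical G 1 S)
    (hG : ∀ v, ¬ G.Adj v v) : #S ≤ energyOn G S := by
  simpa using card_mul_sq_le_energyOn fun v hv => hS.le_outdegreeIn (hG v) hv

theorem IsCritical.isIsomorphic_or_lt_energyOn {S : Finset V} (hS : IsCritical G k S)
    (hG : ∀ v, ¬ G.Adj v v) (hk : 2 ≤ k) :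
    (G.induce S).IsIsomorphic (bidirected (⊤ : SimpleGraph (Fin (k + 1)))) ∨
      #S + (k + 1) ^ 3 < energyOn G S + (k + 1) ^ 2 + (k + 1) := by
  have hout (v : V) (hv : v ∈ S) := hS.le_outdegreeIn (hG v) hv
  obtain ⟨v, hv⟩ := hS.nonempty (zero_lt_two.trans_le hk)
  obtain hcard | hcard := (Nat.succ_le_of_lt
    ((hout v hv).trans_lt (outdegreeIn_lt_card (hG v) hv))).eq_or_lt
  · exact Or.inl (isIsomorphic_bidirected_top_of_card_eq hG hout hcard.symm)
  · exact Or.inr (lt_energyOn_of_not_colorableOn hG hk hS.1 hout hcard)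

theorem IsCritical.card_add_pow_le_energyOn {S : Finset V} (hS : IsCritical G k S)
    (hG : ∀ v, ¬ G.Adj v v) (hk : 2 ≤ k) :
    #S + (k + 1) ^ 3 ≤ energyOn G S + (k + 1) ^ 2 + (k + 1) := by
  obtain hiso | hlt := hS.isIsomorphic_or_lt_energyOn hG hk
  · have hcard : #S = k + 1 := by
      obtain ⟨φ⟩ := hiso
      simpa using Nat.card_congr φ.toEquiv
    rw [hcard, energyOn_eq_of_isIsomorphic_induce hiso, energyOn_bidirected_top]
  · exact hlt.le

variable [Fintype V]

theorem isIsomorphic_directedCycle_two (hG : ∀ v, ¬ G.Adj v v) (h : 1 < G.dichromaticNumber)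
    (hcard : Fintype.card V = 2) : G.IsIsomorphic (directedCycle 2) := by
  obtain ⟨S, hS⟩ := exists_isCritical h
  have hout (v : V) (hv : v ∈ S) := hS.le_outdegreeIn (hG v) hv
  obtain ⟨v, hv⟩ := hS.nonempty one_pos
  have htwo : 2 ≤ #S := (hout v hv).trans_lt (outdegreeIn_lt_card (hG v) hv)
  obtain rfl : S = univ := eq_univ_of_card S (le_antisymm S.card_le_univ (hcard ▸ htwo))
  rw [directedCycle_two]
  refine isIsomorphic_bidirected_top (Nat.card_eq_fintype_card.trans hcard) two_pos fun u w =>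
    ⟨fun huw => ?_, adj_of_card_le_outdegreeIn (hG u) ?_ (mem_univ u) (mem_univ w)⟩
  · rintro rfl
    exact hG u huw
  · rw [card_univ, hcard]
    exact Nat.succ_le_succ (hout u (mem_univ u))

theorem energyOn_eq_four (hG : ∀ v, ¬ G.Adj v v) (h : 1 < G.dichromaticNumber)
    (hcard : Fintype.card V = 2) : energyOn G univ = 4 := by
  rw [energyOn_eq_of_isIsomorphic (isIsomorphic_directedCycle_two hG h hcard), directedCycle_two]
  linarith [energyOn_bidirected_top 2]

theorem card_le_energyOn (hG : ∀ v, ¬ G.Adj v v) (hconn : G.toSimpleGraphInclusive.Connected)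
    (h : 1 < G.dichromaticNumber) : Fintype.card V ≤ energyOn G univ := by
  classical
  obtain ⟨S, hS⟩ := exists_isCritical h
  rw [← card_add_card_compl S]
  exact (Nat.add_le_add_right (hS.card_le_energyOn hG) _).trans
    (energyOn_add_card_compl_le hconn (hS.nonempty one_pos))

theorem energyOn_eq_card_iff (hG : ∀ v, ¬ G.Adj v v) (hconn : G.toSimpleGraphInclusive.Connected)
    (h : 1 < G.dichromaticNumber) :
    energyOn G univ = Fintype.card V ↔ ∃ (l : ℕ) (S : Set V), 3 ≤ l ∧
      (G.induce S).IsIsomorphic (directedCycle l) ∧ G.HasHangingInTrees S := by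
  classical
  constructor
  · intro henergy
    obtain ⟨S, hS⟩ := exists_isCritical h
    have hne := hS.nonempty one_pos
    have hout (v : V) (hv : v ∈ S) := hS.le_outdegreeIn (hG v) hv
    have hcore := hS.card_le_energyOn hG
    have hrest := energyOn_add_card_compl_le hconn hne
    have hcard := card_add_card_compl S
    obtain ⟨l, hl, hiso⟩ := hS.exists_isIsomorphic_directedCycle hG (by omega)
    have hcomplement := HasFunctionalComplement.of_energyOn_eq hconn hne hout (by omega)
    exact ⟨l, S, hl, hiso, hcomplement.hasHangingInTrees hconn hne⟩
  · rintro ⟨l, S, hl, hiso, htrees⟩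
    have hsum := energyOn_add_card_of_hasHangingInTrees hiso htrees
    rw [energyOn_directedCycle hl, Fintype.card_fin, add_comm] at hsum
    exact Nat.add_left_cancel hsum

theorem card_add_pow_le_energyOn (hG : ∀ v, ¬ G.Adj v v)
    (hconn : G.toSimpleGraphInclusive.Connected) (hk : 2 ≤ k)
    (h : k < G.dichromaticNumber) :
    Fintype.card V + (k + 1) ^ 3 ≤ energyOn G univ + (k + 1) ^ 2 + (k + 1) := by
  classical
  obtain ⟨S, hS⟩ := exists_isCritical h
  have hcore := hS.card_add_pow_le_energyOn hG hk
  have hrest := energyOn_add_card_compl_le hconn (hS.nonempty (zero_lt_two.trans_le hk))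
  have hcard := card_add_card_compl S
  omega

theorem energyOn_eq_card_add_pow_iff (hG : ∀ v, ¬ G.Adj v v)
    (hconn : G.toSimpleGraphInclusive.Connected) (hk : 2 ≤ k)
    (h : k < G.dichromaticNumber) :
    energyOn G univ + (k + 1) ^ 2 + (k + 1) = Fintype.card V + (k + 1) ^ 3 ↔
      ∃ S : Set V, (G.induce S).IsIsomorphic (bidirected (⊤ : SimpleGraph (Fin (k + 1)))) ∧
        G.HasHangingInTrees S := by
  classical
  constructor
  · intro henergy
    obtain ⟨S, hS⟩ := exists_isCritical h
    have hne := hS.nonempty (zero_lt_two.trans_le hk)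
    have hout (v : V) (hv : v ∈ S) : 1 ≤ outdegreeIn G S v :=
      (one_le_two.trans hk).trans (hS.le_outdegreeIn (hG v) hv)
    have hcore := hS.card_add_pow_le_energyOn hG hk
    have hrest := energyOn_add_card_compl_le hconn hne
    have hcard := card_add_card_compl S
    have hcomplement := HasFunctionalComplement.of_energyOn_eq hconn hne hout (by omega)
    exact ⟨S, (hS.isIsomorphic_or_lt_energyOn hG hk).resolve_right (by omega),
      hcomplement.hasHangingInTrees hconn hne⟩
  · rintro ⟨S, hiso, htrees⟩
    have hsum := energyOn_add_card_of_hasHangingInTrees hiso htrees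
    have hcore := energyOn_bidirected_top (k + 1)
    rw [Fintype.card_fin] at hsum
    omega

end Extremal

section LaplacianEnergy

variable [Fintype V] [DecidableEq V]

theorem laplacianEnergy_eq_four (hG : G ∈ withDichromaticNumber V 2) (hcard : Fintype.card V = 2) :
    G.laplacianEnergy = 4 := by
  obtain ⟨hloop, -, hr⟩ := hG
  rw [laplacianEnergy_eq_energyOn hloop, energyOn_eq_four hloop (hr ▸ one_lt_two) hcard]
  rfl

theorem card_le_laplacianEnergy (hG : G ∈ withDichromaticNumber V 2) :
    (Fintype.card V : ℂ) ≤ G.laplacianEnergy := by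
  obtain ⟨hloop, hconn, hr⟩ := hG
  rw [laplacianEnergy_eq_energyOn hloop]
  exact_mod_cast card_le_energyOn hloop hconn (hr ▸ one_lt_two)

theorem laplacianEnergy_eq_card_iff (hG : G ∈ withDichromaticNumber V 2) :
    G.laplacianEnergy = Fintype.card V ↔ ∃ (l : ℕ) (S : Set V), 3 ≤ l ∧
      (G.induce S).IsIsomorphic (directedCycle l) ∧ G.HasHangingInTrees S := by
  obtain ⟨hloop, hconn, hr⟩ := hG
  rw [laplacianEnergy_eq_energyOn hloop, Nat.cast_inj]
  exact energyOn_eq_card_iff hloop hconn (hr ▸ one_lt_two)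

variable {r : ℕ}

theorem card_add_pow_le_laplacianEnergy (hG : G ∈ withDichromaticNumber V r) (hr : 3 ≤ r) :
    (Fintype.card V : ℂ) + (r : ℂ) ^ 3 - (r : ℂ) ^ 2 - (r : ℂ) ≤ G.laplacianEnergy := by
  obtain ⟨hloop, hconn, hdi⟩ := hG
  obtain ⟨k, rfl⟩ := Nat.exists_eq_add_of_le' (one_le_two.trans (Nat.le_of_succ_le hr))
  rw [laplacianEnergy_eq_energyOn hloop, sub_le_iff_le_add, sub_le_iff_le_add, add_right_comm]
  exact_mod_cast card_add_pow_le_energyOn hloop hconn (Nat.le_of_succ_le_succ hr)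
    (hdi ▸ Nat.lt_succ_self k)

theorem laplacianEnergy_eq_card_add_pow_iff (hG : G ∈ withDichromaticNumber V r) (hr : 3 ≤ r) :
    G.laplacianEnergy = (Fintype.card V : ℂ) + (r : ℂ) ^ 3 - (r : ℂ) ^ 2 - (r : ℂ) ↔
      ∃ S : Set V, (G.induce S).IsIsomorphic (bidirected (⊤ : SimpleGraph (Fin r))) ∧
        G.HasHangingInTrees S := by
  obtain ⟨hloop, hconn, hdi⟩ := hG
  obtain ⟨k, rfl⟩ := Nat.exists_eq_add_of_le' (one_le_two.trans (Nat.le_of_succ_le hr))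
  rw [laplacianEnergy_eq_energyOn hloop, eq_sub_iff_add_eq, eq_sub_iff_add_eq, add_right_comm,
    ← energyOn_eq_card_add_pow_iff hloop hconn (Nat.le_of_succ_le_succ hr)
      (hdi ▸ Nat.lt_succ_self k)]
  norm_cast

end LaplacianEnergy

end LaplacianEnergy

theorem theorem2p10 {V : Type*} [Fintype V] [DecidableEq V] (n : ℕ) (hn : Fintype.card V = n) :
    -- dichromatic number 2, order 2
    (n = 2 →
      (∃ G ∈ Digraph.withDichromaticNumber V 2, G.laplacianEnergy = 4) ∧
      ∀ G ∈ Digraph.withDichromaticNumber V 2,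
        4 ≤ G.laplacianEnergy ∧
        (G.laplacianEnergy = 4 ↔ G.IsIsomorphic (Digraph.directedCycle 2))) ∧
    -- dichromatic number 2, order at least 3
    (3 ≤ n →
      (∃ G ∈ Digraph.withDichromaticNumber V 2, G.laplacianEnergy = n) ∧
      ∀ G ∈ Digraph.withDichromaticNumber V 2,
        (n : ℂ) ≤ G.laplacianEnergy ∧
        (G.laplacianEnergy = n ↔
          ∃ (l : ℕ) (S : Set V), 3 ≤ l ∧ (G.induce S).IsIsomorphic (Digraph.directedCycle l) ∧
            G.HasHangingInTrees S)) ∧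
    -- dichromatic number at least 3
    (∀ r : ℕ, 3 ≤ r →
      (r ≤ n → ∃ G ∈ Digraph.withDichromaticNumber V r,
        G.laplacianEnergy = (n : ℂ) + (r : ℂ) ^ 3 - (r : ℂ) ^ 2 - (r : ℂ)) ∧
      ∀ G ∈ Digraph.withDichromaticNumber V r,
        (n : ℂ) + (r : ℂ) ^ 3 - (r : ℂ) ^ 2 - (r : ℂ) ≤ G.laplacianEnergy ∧
        (G.laplacianEnergy = (n : ℂ) + (r : ℂ) ^ 3 - (r : ℂ) ^ 2 - (r : ℂ) ↔
          ∃ S : Set V, (G.induce S).IsIsomorphic (Digraph.bidirected (⊤ : SimpleGraph (Fin r))) ∧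
            G.HasHangingInTrees S)) := by
  subst hn
  refine ⟨fun h2 => ⟨?_, fun G hG => ?_⟩, fun h3 => ⟨?_, fun G hG => ?_⟩,
    fun r hr => ⟨fun hrn => ?_, fun G hG => ?_⟩⟩
  · obtain ⟨G, hG, -⟩ := LaplacianEnergy.exists_mem_directedCycle le_rfl h2.ge
    exact ⟨G, hG, LaplacianEnergy.laplacianEnergy_eq_four hG h2⟩
  · have henergy := LaplacianEnergy.laplacianEnergy_eq_four hG h2
    have hiso := LaplacianEnergy.isIsomorphic_directedCycle_two hG.1 (hG.2.2 ▸ one_lt_two) h2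
    exact ⟨henergy.ge, iff_of_true henergy hiso⟩
  · obtain ⟨G, hG, S, h⟩ := LaplacianEnergy.exists_mem_directedCycle (by norm_num) h3
    exact ⟨G, hG, (LaplacianEnergy.laplacianEnergy_eq_card_iff hG).mpr ⟨3, S, le_rfl, h⟩⟩
  · exact ⟨LaplacianEnergy.card_le_laplacianEnergy hG,
      LaplacianEnergy.laplacianEnergy_eq_card_iff hG⟩
  · obtain ⟨G, hG, h⟩ := LaplacianEnergy.exists_mem_bidirected_top (by omega) hrn
    exact ⟨G, hG, (LaplacianEnergy.laplacianEnergy_eq_card_add_pow_iff hG hr).mpr h⟩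
  · exact ⟨LaplacianEnergy.card_add_pow_le_laplacianEnergy hG hr,
      LaplacianEnergy.laplacianEnergy_eq_card_add_pow_iff hG hr⟩
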